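/- Let $B$ be a unital commutative semisimple complex Banach algebra whose maximal ideal space $X$ (the set of characters of $B$, with the weak* topology) is connected. For $f\in B$ and $x \in X$ write $\hat f(x)=x(f)$. For $x,y\in X$ let $\|x-y\|=\sup\{|\hat f(x)-\hat f(y)| : f\in B,\ \|f\|\le 1\}$, the norm of $x-y$ in $B^*$, and for $a\in X$, $\varepsilon>0$ let $B(a,\varepsilon)=\{x\in X:\|x-a\|<\varepsilon\}$. A bounded linear operator $T$ on a complex Banach space $E$ is called a Riesz operator if for every $\lambda\neq 0$: (a) $\lambda-T$ is an open map onto its range; (b) the range of $\lambda-T$ is closed; (c) the dimension of the kernel and the codimension of the range of $\lambda-T$ are finite and equal; (d) the lengths of the chains $\ker(\lambda-T)^n$ and $\operatorname{ran}(\lambda-T)^n$, $n\ge 0$, are finite and equal; and moreover (e) the non-zero spectrum of $T$ consists of eigenvalues and, if there are infinitely many of them, they form a sequence converging to $0$. **Theorem.** Let $T:B\to B$ be an endomorphism (a linear and multiplicative map) which is a Riesz operator and is induced by a selfmap $\varphi$ of $X$, that is, $\widehat{Tf}(x)=\hat f(\varphi(x))$ for all $f\in B$ and $x\in X$. Let $\varphi_n$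 denote the $n$-th iterate of $\varphi$, and suppose that $\bigcap_{n=0}^\infty \varphi_n(X)=\{x_0\}$. Then for every $\varepsilon>0$ there is a positive integer $N$ such that $\varphi_N(X)\subset B(x_0,\varepsilon)$. -/

import Mathlib

open Set Filter Topology

/-- A bounded linear operator `T` on a complex Banach space is a *Riesz operator* if, for every
non-zero scalar `z`, the operator `z - T` is open onto its range, has closed range, has kernel and
cokernel of finite and equal dimension, and has null chain and image chain of finite and equal
length, and if moreover the non-zero spectrum of `T` consists of eigenvalues which, if there are
infinitely many of them, form a sequence approaching `0`. -/
structure IsRieszOperator {E : Type*} [NormedAddCommGroup E] [NormedSpace ℂ E]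
    (T : E →L[ℂ] E) : Prop where
  /-- `z - T` is an open mapping onto its range. -/
  isOpenMap : ∀ z : ℂ, z ≠ 0 →
    IsOpenMap (Set.rangeFactorization (z • ContinuousLinearMap.id ℂ E - T))
  /-- `z - T` has closed range. -/
  isClosed_range : ∀ z : ℂ, z ≠ 0 →
    IsClosed (Set.range (z • ContinuousLinearMap.id ℂ E - T))
  /-- The kernel of `z - T` is finite dimensional. -/
  finite_ker : ∀ z : ℂ, z ≠ 0 →
    FiniteDimensional ℂ (z • ContinuousLinearMap.id ℂ E - T).ker
  /-- The range of `z - T` has finite codimension. -/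
  finite_coker : ∀ z : ℂ, z ≠ 0 →
    FiniteDimensional ℂ (E ⧸ (z • ContinuousLinearMap.id ℂ E - T).range)
  /-- The dimension of the kernel is the codimension of the range. -/
  finrank_eq : ∀ z : ℂ, z ≠ 0 →
    Module.finrank ℂ (z • ContinuousLinearMap.id ℂ E - T).ker =
      Module.finrank ℂ (E ⧸ (z • ContinuousLinearMap.id ℂ E - T).range)
  /-- The null chain and the image chain of `z - T` have finite and equal lengths; the length of a
  chain is the least `n` at which its `n`-th and `(n + 1)`-st terms agree. -/
  chains : ∀ z : ℂ, z ≠ 0 → ∃ p : ℕ,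
    IsLeast {n : ℕ | ((z • ContinuousLinearMap.id ℂ E - T) ^ n).ker =
      ((z • ContinuousLinearMap.id ℂ E - T) ^ (n + 1)).ker} p ∧
    IsLeast {n : ℕ | ((z • ContinuousLinearMap.id ℂ E - T) ^ n).range =
      ((z • ContinuousLinearMap.id ℂ E - T) ^ (n + 1)).range} p
  /-- Every non-zero point of the spectrum is an eigenvalue. -/
  hasEigenvalue : ∀ z ∈ spectrum ℂ T, z ≠ 0 →
    Module.End.HasEigenvalue (T : E →ₗ[ℂ] E) z
  /-- If the non-zero spectrum is infinite, it forms a sequence approaching `0`. -/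
  tendsto_zero : (spectrum ℂ T \ {0}).Infinite →
    ∃ u : ℕ → ℂ, Function.Injective u ∧ Set.range u = spectrum ℂ T \ {0} ∧
      Tendsto u atTop (𝓝 0)

namespace MaximalIdealSpace

variable {B : Type*} [NormedCommRing B] [NormedAlgebra ℂ B]

/-- The distance `‖x - y‖ = sup {|f̂(x) - f̂(y)| : ‖f‖ ≤ 1}` of two points of the maximal ideal
space (the characters of `B` with the weak* topology), where `f̂(x) = x f`. This is the norm of
`x - y` in the dual space of `B`. -/
noncomputable def normDist (x y : WeakDual.characterSpace ℂ B) : ℝ :=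
  sSup {r : ℝ | ∃ f : B, ‖f‖ ≤ 1 ∧ r = ‖x f - y f‖}

/-- The open ball `B(a, ε)` in the maximal ideal space with respect to the norm of the dual. -/
def normBall (a : WeakDual.characterSpace ℂ B) (ε : ℝ) : Set (WeakDual.characterSpace ℂ B) :=
  {x | normDist x a < ε}

/-- `φ` induces `T`: the Gelfand transform of `T f` is the Gelfand transform of `f` composed
with `φ`. -/
def Induces (φ : WeakDual.characterSpace ℂ B → WeakDual.characterSpace ℂ B)
    (T : B →L[ℂ] B) : Prop :=
  ∀ (f : B) (x : WeakDual.characterSpace ℂ B), x (T f) = (φ x) f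

end MaximalIdealSpace

open MaximalIdealSpace

section PowTendsto

variable {A : Type*} [NormedRing A] [NormedAlgebra ℂ A] [CompleteSpace A]

/-! Let `S = T - P` with `P f = x₀(f) • 1`. Since `φ` fixes `x₀`, evaluating `S ^ n f` at `x` for `n
≥ 1` gives `f̂(φⁿ x) - f̂(x₀)`, so it suffices that `‖S ^ n‖ → 0`, i.e. that the spectrum of `S`
lies in the open unit disc (`norm_lt_one_of_mem_spectrum_sub_evalProj`). By compactness all orbits
converge to `x₀`, which forces eigenvectors of `T` with `1 ≤ ‖z‖` to vanish once they vanish at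
`x₀`. Hence 1 is the only eigenvalue there, its eigenvectors are the constants, and subtracting `P`
removes it; the Riesz property turns this into surjectivity of `z - S`. -/

/-- The powers of an element whose spectrum lies in the open unit disc tend to `0`. -/
theorem tendsto_pow_zero_of_spectrum_norm_lt_one [Nontrivial A] (a : A)
    (ha : ∀ z ∈ spectrum ℂ a, ‖z‖ < 1) : Tendsto (fun n : ℕ => ‖a ^ n‖) atTop (𝓝 0) := by
  have hlt : spectralRadius ℂ a < ((1 : NNReal) : ENNReal) :=
    spectrum.spectralRadius_lt_of_forall_lt a fun z hz => by
      simpa [← NNReal.coe_lt_coe] using ha z hz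
  obtain ⟨r, hr, hr1⟩ := ENNReal.lt_iff_exists_nnreal_btwn.1 hlt
  have hr1' : r < 1 := by exact_mod_cast hr1
  have hev := (spectrum.pow_nnnorm_pow_one_div_tendsto_nhds_spectralRadius a).eventually_lt_const hr
  refine squeeze_zero' (Eventually.of_forall fun n => norm_nonneg _) ?_
    (tendsto_pow_atTop_nhds_zero_of_lt_one r.coe_nonneg (by exact_mod_cast hr1'))
  filter_upwards [hev, eventually_gt_atTop 0] with n hn hpos
  have hn0 : (0 : ℝ) < n := by exact_mod_cast hpos
  rw [one_div, ENNReal.rpow_inv_lt_iff hn0, ENNReal.rpow_natCast] at hn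
  have h : ‖a ^ n‖₊ < r ^ n := by exact_mod_cast hn
  exact_mod_cast h.le

end PowTendsto

namespace MaximalIdealSpace

variable {B : Type*} [NormedCommRing B] [NormedAlgebra ℂ B]

/-- In a semisimple algebra the characters separate points from `0`. -/
theorem eq_zero_of_forall_apply_eq_zero [CompleteSpace B] (hss : Ring.jacobson B = ⊥) {f : B}
    (hf : ∀ x : WeakDual.characterSpace ℂ B, x f = 0) : f = 0 := by
  have hmem : f ∈ Ideal.jacobson (⊥ : Ideal B) := by
    rw [Ideal.mem_jacobson_bot]
    intro y
    by_contra h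
    obtain ⟨x, hx⟩ := WeakDual.CharacterSpace.exists_apply_eq_zero h
    simp [hf x] at hx
  rw [Ideal.jacobson_bot, hss] at hmem
  simpa using hmem

theorem ext_of_forall_apply_eq [CompleteSpace B] (hss : Ring.jacobson B = ⊥) {f g : B}
    (h : ∀ x : WeakDual.characterSpace ℂ B, x f = x g) : f = g :=
  sub_eq_zero.1 <| eq_zero_of_forall_apply_eq_zero hss fun x => by rw [map_sub, h x, sub_self]

variable {T : B →L[ℂ] B} {φ : WeakDual.characterSpace ℂ B → WeakDual.characterSpace ℂ B}
  {x₀ : WeakDual.characterSpace ℂ B}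

theorem Induces.continuous (hφ : Induces φ T) : Continuous φ := by
  refine Continuous.subtype_mk (WeakDual.continuous_of_continuous_eval fun f => ?_) _
  have h : Continuous fun x : WeakDual.characterSpace ℂ B => x (T f) :=
    (WeakDual.eval_continuous (T f)).comp continuous_subtype_val
  exact h.congr fun x => hφ f x

theorem Induces.map_one [CompleteSpace B] (hss : Ring.jacobson B = ⊥) (hφ : Induces φ T) :
    T 1 = 1 :=
  ext_of_forall_apply_eq hss fun x => by rw [hφ]; simp

/-- `φ` maps each iterated image into itself, hence also their intersection. -/
theorem apply_eq_of_iInter_range_iterate {X : Type*} {φ : X → X} {x₀ : X}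
    (h : ⋂ n : ℕ, Set.range (φ^[n]) = {x₀}) : φ x₀ = x₀ := by
  have hx : ∀ n, x₀ ∈ Set.range (φ^[n]) := Set.mem_iInter.1 (h ▸ Set.mem_singleton x₀)
  rw [← Set.mem_singleton_iff, ← h, Set.mem_iInter]
  intro n
  obtain ⟨y, rfl⟩ := hx n
  exact ⟨φ y, Function.Commute.iterate_self φ n y⟩

/-- Under a continuous selfmap of a compact Hausdorff space whose iterated images intersect in a
single point, every orbit converges to that point. -/
theorem tendsto_iterate_of_iInter_range {X : Type*} [TopologicalSpace X] [CompactSpace X]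
    [T2Space X] {φ : X → X} (hφ : Continuous φ) {x₀ : X}
    (h : ⋂ n : ℕ, Set.range (φ^[n]) = {x₀}) (x : X) :
    Tendsto (fun n => φ^[n] x) atTop (𝓝 x₀) := by
  have hanti : Antitone fun n : ℕ => Set.range (φ^[n]) := by
    refine antitone_nat_of_succ_le fun n => ?_
    rintro _ ⟨y, rfl⟩
    exact ⟨φ y, rfl⟩
  intro U hU
  obtain ⟨N, hN⟩ := exists_subset_nhds_of_compactSpace (V := fun n : ℕ => Set.range (φ^[n]))
    (directed_of_isDirected_le hanti) (fun n => (isCompact_range (hφ.iterate n)).isClosed)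
    (U := U) (fun y hy => by rw [h, Set.mem_singleton_iff] at hy; exact hy ▸ hU)
  exact mem_map.2 <| mem_of_superset (Ici_mem_atTop N) fun n hn => hN (hanti hn ⟨x, rfl⟩)

theorem Induces.apply_iterate_of_eigenvector (hφ : Induces φ T) {z : ℂ} {f : B}
    (hf : T f = z • f) (n : ℕ) (x : WeakDual.characterSpace ℂ B) :
    (φ^[n] x) f = z ^ n * x f := by
  induction n generalizing x with
  | zero => simp
  | succ n ih =>
    rw [Function.iterate_succ_apply, ih, ← hφ, hf, map_smul, smul_eq_mul, pow_succ, mul_assoc]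

/-- An eigenvector of `T` for an eigenvalue outside the open unit disc vanishes if it vanishes at a
character which attracts all characters under `φ`. -/
theorem Induces.eigenvector_eq_zero [CompleteSpace B] (hss : Ring.jacobson B = ⊥)
    (hφ : Induces φ T) (hlim : ∀ x, Tendsto (fun n => φ^[n] x) atTop (𝓝 x₀)) {z : ℂ}
    (hz : 1 ≤ ‖z‖) {f : B} (hf : T f = z • f) (hf₀ : x₀ f = 0) : f = 0 := by
  refine eq_zero_of_forall_apply_eq_zero hss fun x => ?_
  have hcont : Continuous fun x : WeakDual.characterSpace ℂ B => x f :=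
    (WeakDual.eval_continuous f).comp continuous_subtype_val
  have h : Tendsto (fun n : ℕ => ‖(φ^[n] x) f‖) atTop (𝓝 0) := by
    have := ((hcont.tendsto x₀).comp (hlim x)).norm
    simpa only [hf₀, norm_zero, Function.comp_def] using this
  have hle : ‖x f‖ ≤ 0 := ge_of_tendsto' h fun n => by
    rw [hφ.apply_iterate_of_eigenvector hf, norm_mul, norm_pow]
    exact le_mul_of_one_le_left (norm_nonneg _) (one_le_pow₀ hz)
  exact norm_le_zero_iff.1 hle

/-- The rank one projection `f ↦ f̂(x₀) 1`. -/
noncomputable def evalProj (x₀ : WeakDual.characterSpace ℂ B) : B →L[ℂ] B :=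
  (WeakDual.CharacterSpace.toCLM x₀ : B →L[ℂ] ℂ).smulRight (1 : B)

@[simp]
theorem evalProj_apply (x₀ : WeakDual.characterSpace ℂ B) (f : B) :
    evalProj x₀ f = x₀ f • (1 : B) := rfl

/-- The terms in `x₀ f` telescope because `x₀` is fixed. The exponent must be positive: the identity
operator does not subtract `x₀ f`. -/
theorem Induces.apply_sub_evalProj_pow (hφ : Induces φ T) (hfix : φ x₀ = x₀) (f : B) (n : ℕ)
    (x : WeakDual.characterSpace ℂ B) :
    x (((T - evalProj x₀) ^ (n + 1)) f) = (φ^[n + 1] x) f - x₀ f := by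
  have hstep : ∀ (x : WeakDual.characterSpace ℂ B) (g : B),
      x ((T - evalProj x₀) g) = φ x g - x₀ g := fun x g => by
    simp [hφ g x]
  induction n generalizing x with
  | zero => simpa using hstep x f
  | succ n ih =>
    rw [pow_succ', mul_apply_eq_comp, hstep, ih, ih,
      Function.iterate_fixed hfix, Function.iterate_succ_apply _ (n + 1)]
    simp

section Spectrum

variable [CompleteSpace B]

/-- Modulo the range of `1 - T`, every element is the constant given by its value at `x₀`. -/
theorem exists_sub_apply_eq_sub_smul_one (hss : Ring.jacobson B = ⊥) (hT : IsRieszOperator T)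
    (hφ : Induces φ T) (hfix : φ x₀ = x₀)
    (hlim : ∀ x, Tendsto (fun n => φ^[n] x) atTop (𝓝 x₀)) (g : B) :
    ∃ (h : B) (c : ℂ), h - T h = g - c • (1 : B) := by
  set D : B →L[ℂ] B := (1 : ℂ) • ContinuousLinearMap.id ℂ B - T with hD
  have hDapp : ∀ f, D f = f - T f := fun f => by simp [hD]
  have hone : T 1 = 1 := hφ.map_one hss
  have hx₀ : ∀ f, x₀ (D f) = 0 := fun f => by rw [hDapp, map_sub, hφ, hfix, sub_self]
  have h1 : (1 : B) ≠ 0 := fun h => by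
    have := map_one x₀
    rw [h, map_zero] at this
    exact zero_ne_one this
  have hker : Module.finrank ℂ D.ker = 1 := by
    refine finrank_eq_one (⟨1, by simp [hDapp, hone]⟩ : D.ker)
      (fun h => h1 (congrArg Subtype.val h)) ?_
    rintro ⟨f, hf⟩
    have hf' : T f = f := by
      have : D f = 0 := hf
      rw [hDapp, sub_eq_zero] at this
      exact this.symm
    refine ⟨x₀ f, Subtype.ext ?_⟩
    -- Subtracting the constant makes the fixed vector vanish at `x₀`.
    have : f - x₀ f • (1 : B) = 0 :=
      hφ.eigenvector_eq_zero hss hlim (z := 1) (by simp) (by simp [hf', hone]) (by simp)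
    exact (sub_eq_zero.1 this).symm
  have hquot : Module.finrank ℂ (B ⧸ D.range) = 1 := by
    rw [← hT.finrank_eq 1 one_ne_zero, hker]
  -- The range of `1 - T` lies in the kernel of `x₀`, so the class of 1 spans the one-dimensional
  -- cokernel.
  have hne : D.range.mkQ 1 ≠ 0 := fun h => by
    obtain ⟨f, hf⟩ := (Submodule.Quotient.mk_eq_zero _).1 h
    have := hx₀ f
    rw [show D f = 1 from hf, map_one] at this
    exact one_ne_zero this
  obtain ⟨c, hc⟩ := exists_smul_eq_of_finrank_eq_one hquot hne (D.range.mkQ g)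
  rw [← map_smul] at hc
  obtain ⟨h, hh⟩ := (Submodule.Quotient.eq _).1 hc.symm
  exact ⟨h, c, (hDapp h).symm.trans hh⟩

theorem surjective_smul_id_sub (hss : Ring.jacobson B = ⊥) (hT : IsRieszOperator T)
    (hφ : Induces φ T) (hfix : φ x₀ = x₀)
    (hlim : ∀ x, Tendsto (fun n => φ^[n] x) atTop (𝓝 x₀)) {z : ℂ} (hz : 1 ≤ ‖z‖)
    (hz1 : z ≠ 1) (g : B) : ∃ h : B, z • h - T h = g := by
  have hz0 : z ≠ 0 := norm_pos_iff.1 (zero_lt_one.trans_le hz)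
  have hnot : z ∉ spectrum ℂ T := fun hmem => by
    obtain ⟨f, hf⟩ := (hT.hasEigenvalue z hmem hz0).exists_hasEigenvector
    have hTf : T f = z • f := hf.apply_eq_smul
    have h0 : x₀ f = z * x₀ f := by
      rw [← smul_eq_mul, ← map_smul, ← hTf, hφ, hfix]
    have hf0 : x₀ f = 0 := by
      have : (z - 1) * x₀ f = 0 := by rw [sub_mul, one_mul, ← h0, sub_self]
      exact (mul_eq_zero.1 this).resolve_left (sub_ne_zero.2 hz1)
    exact hf.2 (hφ.eigenvector_eq_zero hss hlim hz hTf hf0)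
  rw [spectrum.notMem_iff, ContinuousLinearMap.isUnit_iff_bijective] at hnot
  obtain ⟨h, hh⟩ := hnot.2 g
  exact ⟨h, by simpa [Algebra.algebraMap_eq_smul_one] using hh⟩

theorem norm_lt_one_of_mem_spectrum_sub_evalProj (hss : Ring.jacobson B = ⊥)
    (hT : IsRieszOperator T) (hφ : Induces φ T) (hfix : φ x₀ = x₀)
    (hlim : ∀ x, Tendsto (fun n => φ^[n] x) atTop (𝓝 x₀)) {z : ℂ}
    (hz : z ∈ spectrum ℂ (T - evalProj x₀)) : ‖z‖ < 1 := by
  by_contra! hz1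
  have hz0 : z ≠ 0 := norm_pos_iff.1 (zero_lt_one.trans_le hz1)
  refine hz ?_
  have hone : T 1 = 1 := hφ.map_one hss
  have happ : ∀ f, (algebraMap ℂ (B →L[ℂ] B) z - (T - evalProj x₀)) f
      = z • f - T f + x₀ f • (1 : B) := fun f => by
    simp [Algebra.algebraMap_eq_smul_one, sub_add]
  rw [spectrum.mem_resolventSet_iff, ContinuousLinearMap.isUnit_iff_bijective]
  constructor
  · rw [injective_iff_map_eq_zero]
    intro f hf
    rw [happ] at hf
    have hf0 : x₀ f = 0 := by
      have := congrArg x₀ hf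
      simpa [hφ f x₀, hfix, hz0] using this
    rw [hf0, zero_smul, add_zero, sub_eq_zero] at hf
    exact hφ.eigenvector_eq_zero hss hlim hz1 hf.symm hf0
  · intro g
    by_cases h1 : z = 1
    · obtain ⟨h, c, hh⟩ := exists_sub_apply_eq_sub_smul_one hss hT hφ hfix hlim g
      -- As `S` kills constants, `z - S` multiplies them by `z`; a constant therefore corrects the
      -- error, here and in the other case.
      refine ⟨h + (c - x₀ h) • (1 : B), ?_⟩
      rw [happ, h1, eq_add_of_sub_eq' hh.symm]
      simp only [map_add, map_smul, hone, map_one, smul_eq_mul]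
      module
    · obtain ⟨h, hh⟩ := surjective_smul_id_sub hss hT hφ hfix hlim hz1 h1 g
      refine ⟨h + (-(x₀ h / z)) • (1 : B), ?_⟩
      rw [happ, ← hh]
      simp only [map_add, map_smul, hone, map_one, smul_eq_mul]
      match_scalars
      all_goals field_simp
      ring

end Spectrum

end MaximalIdealSpace

theorem theorem1p2 {B : Type*} [NormedCommRing B] [NormedAlgebra ℂ B] [CompleteSpace B]
    (hss : Ring.jacobson B = ⊥)
    (hconn : ConnectedSpace (WeakDual.characterSpace ℂ B))
    (T : B →L[ℂ] B) (hmul : ∀ f g : B, T (f * g) = T f * T g)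
    (hT : IsRieszOperator T)
    (φ : WeakDual.characterSpace ℂ B → WeakDual.characterSpace ℂ B)
    (hφ : MaximalIdealSpace.Induces φ T)
    (x₀ : WeakDual.characterSpace ℂ B)
    (hx₀ : ⋂ n : ℕ, Set.range (φ^[n]) = {x₀})
    (ε : ℝ) (hε : 0 < ε) :
    ∃ N : ℕ, 0 < N ∧ Set.range (φ^[N]) ⊆ MaximalIdealSpace.normBall x₀ ε := by
  have hfix : φ x₀ = x₀ := apply_eq_of_iInter_range_iterate hx₀
  have hlim := tendsto_iterate_of_iInter_range hφ.continuous hx₀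
  have h1 : (1 : B) ≠ 0 := fun h => by
    have := map_one x₀
    rw [h, map_zero] at this
    exact zero_ne_one this
  have : Nontrivial B := ⟨1, 0, h1⟩
  have hpow := tendsto_pow_zero_of_spectrum_norm_lt_one (T - evalProj x₀) fun z hz =>
    norm_lt_one_of_mem_spectrum_sub_evalProj hss hT hφ hfix hlim hz
  -- The factor `‖1‖` bounds the norm of every character; it need not be 1.
  have hsucc := (hpow.comp (tendsto_add_atTop_nat 1)).mul_const ‖(1 : B)‖
  rw [zero_mul] at hsucc
  obtain ⟨n, hn⟩ := (hsucc.eventually_lt_const hε).exists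
  refine ⟨n + 1, n.succ_pos, ?_⟩
  rintro _ ⟨x, rfl⟩
  have hne : {r : ℝ | ∃ f : B, ‖f‖ ≤ 1 ∧ r = ‖(φ^[n + 1] x) f - x₀ f‖}.Nonempty :=
    ⟨_, 0, by simp, rfl⟩
  refine lt_of_le_of_lt (csSup_le hne ?_) hn
  rintro _ ⟨f, hf, rfl⟩
  rw [← hφ.apply_sub_evalProj_pow hfix]
  refine (AlgHom.norm_apply_le_self_mul_norm_one x _).trans ?_
  gcongr
  exact ContinuousLinearMap.unit_le_opNorm _ _ hf
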